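/- Let $I\subseteq\mathbb R$ be an interval, $a,b\in I^\circ$ with $a<b$, and let $(Q_k)_{k\ge 0}$ be a harmonic (Appell) sequence of real polynomials, i.e. $Q_0=1$ and $Q_k'=Q_{k-1}$ for $k\ge1$. Let $n\ge2$ and let $f:I\to\mathbb R$ be $(n+1)$-times differentiable on $I^\circ$ with $f^{(n+1)}$ absolutely continuous on (every compact subinterval of) $I^\circ$. For $x\in\left[a,\frac{a+b}{2}\right]$ put $$S(t,x)=\begin{cases} t-a, & t\in[a,x],\\ t-\frac{a+b}{2}, & t\in(x,a+b-x),\\ t-b, & t\in[a+b-x,b]\end{cases}$$ (with the value $t-a$ at $t=x$ if $x=\frac{a+b}2$), and $$\mathcal L(f,Q_n,x)=\frac{(-1)^{n-1}}{n(b-a)}\int_a^b Q_{n-1}(t)S(t,x)f^{(n)}(t)\,dt-\left[\frac{Q_n(x)+Q_n(a+b-x)}{2}-\frac{Q_{n+1}(b)-Q_{n+1}(a)}{b-a}\right]\frac{(-1)^{n-1}}{n}\cdot\frac{f^{(n-1)}(b)-f^{(n-1)}(a)}{b-a}.$$ Let $\|\cdot\|_p$ be the norm of $L_p([a,b])$,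 and let $$M_2=\sup_{a\le t\le b}Q_{n-1}(t)S(t,x),\qquad m_2=\inf_{a\le t\le b}Q_{n-1}(t)S(t,x),\qquad D(n,x)=\left(\int_a^b\left|Q_{n-1}(t)+Q_{n-2}(t)S(t,x)\right|^2dt\right)^{1/2}.$$ Then for every $x\in\left[a,\frac{a+b}{2}\right]$ the following hold. 1. If $f^{(n+1)}\in L_\infty([a,b])$, then $\displaystyle|\mathcal L(f,Q_n,x)|\le\frac{(b-a)^2}{12n}\left\|Q_{n-1}+Q_{n-2}S(\cdot,x)\right\|_\infty\left\|f^{(n+1)}\right\|_\infty.$ 2. If $m_1\le f^{(n)}\le M_1$ on $[a,b]$, then $\displaystyle|\mathcal L(f,Q_n,x)|\le\frac{1}{4n}(M_1-m_1)(M_2-m_2).$ 3. If $f^{(n+1)}\in L_2([a,b])$, then $\displaystyle|\mathcal L(f,Q_n,x)|\le\frac{b-a}{\pi^2n}\,D(n,x)\left\|f^{(n+1)}\right\|_2.$ 4. If $m_1\le f^{(n)}\le M_1$ on $[a,b]$, then $\displaystyle|\mathcal L(f,Q_n,x)|\le\frac{b-a}{8n}\left\|Q_{n-1}+Q_{n-2}S(\cdot,x)\right\|_\infty(M_1-m_1).$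 5. If $f^{(n+1)}\in L_\infty([a,b])$, then $\displaystyle|\mathcal L(f,Q_n,x)|\le\frac{b-a}{8n}(M_2-m_2)\left\|f^{(n+1)}\right\|_\infty.$ -/

import Mathlib

open MeasureTheory Set

noncomputable section

namespace GuessabSchmeisser

/-- A harmonic (Appell) sequence of polynomials: `Q 0 = 1` and `(Q (k + 1))' = Q k`. -/
def IsHarmonicSeq (Q : ℕ → Polynomial ℝ) : Prop :=
  Q 0 = 1 ∧ ∀ k, Polynomial.derivative (Q (k + 1)) = Q k

/-- Absolute continuity of `g` on an interval `J`: `g` is absolutely continuous on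
every compact subinterval of `J`. -/
def IsAbsContOn (g : ℝ → ℝ) (J : Set ℝ) : Prop :=
  ∀ c ∈ J, ∀ d ∈ J, c ≤ d → AbsolutelyContinuousOnInterval g c d

/-- The kernel `S(t, x)` on `[a, b]`: `t - a` on `[a, x]`, `t - (a + b) / 2` on
`(x, a + b - x)`, and `t - b` on `[a + b - x, b]`. -/
def kernelS (a b x t : ℝ) : ℝ :=
  if t ≤ x then t - a else if t < a + b - x then t - (a + b) / 2 else t - b

/-- The `L^p` norm over `[a, b]` (for `p = ∞` the essential supremum of the absolute value). -/
def normOn (a b : ℝ) (p : ENNReal) (g : ℝ → ℝ) : ℝ :=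
  (eLpNorm g p (volume.restrict (Icc a b))).toReal

/-- `g ∈ L_p([a, b])`. -/
def MemLpOn (a b : ℝ) (p : ENNReal) (g : ℝ → ℝ) : Prop :=
  MemLp g p (volume.restrict (Icc a b))

/-- The remainder `L(f, Q_n, x)`. -/
def remainderL (a b : ℝ) (Q : ℕ → Polynomial ℝ) (n : ℕ) (f : ℝ → ℝ) (x : ℝ) : ℝ :=
  (-1) ^ (n - 1) / ((n : ℝ) * (b - a)) *
      (∫ t in a..b, (Q (n - 1)).eval t * kernelS a b x t * iteratedDeriv n f t)
    - (((Q n).eval x + (Q n).eval (a + b - x)) / 2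
        - ((Q (n + 1)).eval b - (Q (n + 1)).eval a) / (b - a))
      * ((-1) ^ (n - 1) / (n : ℝ))
      * ((iteratedDeriv (n - 1) f b - iteratedDeriv (n - 1) f a) / (b - a))

/-- The function `t ↦ Q_{n-1}(t) S(t, x)`. -/
def qS (a b : ℝ) (Q : ℕ → Polynomial ℝ) (n : ℕ) (x t : ℝ) : ℝ :=
  (Q (n - 1)).eval t * kernelS a b x t

/-- The function `t ↦ Q_{n-1}(t) + Q_{n-2}(t) S(t, x)` (used for `n ≥ 2`). -/
def qDS (a b : ℝ) (Q : ℕ → Polynomial ℝ) (n : ℕ) (x t : ℝ) : ℝ :=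
  (Q (n - 1)).eval t + (Q (n - 2)).eval t * kernelS a b x t

/-- The upper range bound `M₂` of `Q_{n-1} S(·, x)` on `[a, b]`. -/
def upperM (a b : ℝ) (Q : ℕ → Polynomial ℝ) (n : ℕ) (x : ℝ) : ℝ :=
  sSup (qS a b Q n x '' Icc a b)

/-- The lower range bound `m₂` of `Q_{n-1} S(·, x)` on `[a, b]`. -/
def lowerM (a b : ℝ) (Q : ℕ → Polynomial ℝ) (n : ℕ) (x : ℝ) : ℝ :=
  sInf (qS a b Q n x '' Icc a b)

/-- `D(n, x)`. -/
def normD (a b : ℝ) (Q : ℕ → Polynomial ℝ) (n : ℕ) (x : ℝ) : ℝ :=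
  Real.sqrt (∫ t in a..b, |qDS a b Q n x t| ^ 2)

end GuessabSchmeisser

end

/-! Put `h = Q_{n-1} S(·, x)` and `g = f^{(n)}`. The bracket in the remainder is the mean of `h`,
and the divided difference of `f^{(n-1)}` is the mean of `g`. Hence, up to sign, the remainder is `1
/ (n (b - a))` times the Chebyshev functional `∫ h g - (∫ h)(∫ g) / (b - a)`. The five estimates are
those of Chebyshev, Grüss, Lupaş and Ostrowski (twice, with the roles of `h` and `g` exchanged).

The obstacle is that `h` may jump at `x` and `a + b - x`, so it need not be Lipschitz or absolutely
continuous. What saves the constants is that on each of the three pieces `h` is `Q_{n-1}(t) (t - e)`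
with `e` in that piece (`e = a`, the midpoint, `b`). So every branch vanishes at its own `e`, and
its derivative is `Q_{n-1} + Q_{n-2} S`.

For the two `L_2` estimates, Cauchy–Schwarz allows arbitrary constants to be subtracted from `h` and
`g`. With 0 for `h`, the norm splits over the pieces and is bounded by `|h| ≤ K |t - e|` or by
Wirtinger's inequality from the zeros; with the midpoint value for `g`, the same works. Grüss uses
the midpoints of the two ranges.

For Ostrowski, the Lipschitz condition is weakened to `HasValueDensity`: between two attained levels
`p < q`, the function spends measure at least `(q - p) / K`. Jumps between branches that all pass
through 0 do not destroy this, and it suffices for the sharp bound on the mean deviation. -/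

namespace GuessabSchmeisser

/-! ### The Chebyshev functional on a finite measure space -/

section Chebyshev

variable {α : Type*} [MeasurableSpace α] {μ : Measure α} {h g : α → ℝ}

/-- `g` minus its mean integrates to zero, so the constant `c` is free. Each bound chooses its own.
-/
theorem integral_sub_mul_sub_average [IsFiniteMeasure μ] (hμ : μ.real univ ≠ 0) (hh : MemLp h 2 μ) (hg : MemLp g 2 μ)
    (c : ℝ) :
    ∫ t, (h t - c) * (g t - (∫ s, g s ∂μ) / μ.real univ) ∂μ
      = ∫ t, h t * g t ∂μ - (∫ t, h t ∂μ) * (∫ t, g t ∂μ) / μ.real univ := by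
  set d := (∫ s, g s ∂μ) / μ.real univ with hd
  have i1 : Integrable (fun t => h t * g t) μ := hh.integrable_mul hg
  have i2 : Integrable h μ := hh.integrable (by norm_num)
  have i3 : Integrable g μ := hg.integrable (by norm_num)
  have e : (fun t => (h t - c) * (g t - d))
      = fun t => h t * g t - d * h t - c * g t + c * d := by
    ext t; ring
  have hgd : ∫ t, g t ∂μ = d * μ.real univ := by rw [hd]; field_simp
  have j1 : Integrable (fun t => h t * g t - d * h t) μ := i1.sub (i2.const_mul d)
  have j2 : Integrable (fun t => h t * g t - d * h t - c * g t) μ := j1.sub (i3.const_mul c)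
  rw [e, integral_add j2 (integrable_const _), integral_sub j1 (i3.const_mul c),
    integral_sub i1 (i2.const_mul d),
    integral_const_mul, integral_const_mul, integral_const, hgd, smul_eq_mul]
  field_simp
  ring

/-- The mean is the best constant in `L_2`, so any convenient `d` can replace it in an upper bound.
-/
theorem integral_sq_sub_average_le [IsFiniteMeasure μ] (hμ : μ.real univ ≠ 0) (hg : MemLp g 2 μ) (d : ℝ) :
    ∫ t, (g t - (∫ s, g s ∂μ) / μ.real univ) ^ 2 ∂μ ≤ ∫ t, (g t - d) ^ 2 ∂μ := by
  have i1 : Integrable (fun t => g t ^ 2) μ := hg.integrable_sq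
  have i3 : Integrable g μ := hg.integrable (by norm_num)
  have key : ∀ c : ℝ, ∫ t, (g t - c) ^ 2 ∂μ
      = ∫ t, g t ^ 2 ∂μ - 2 * c * ∫ t, g t ∂μ + c ^ 2 * μ.real univ := by
    intro c
    have e : (fun t => (g t - c) ^ 2) = fun t => g t ^ 2 - 2 * c * g t + c ^ 2 := by
      ext t; ring
    have j1 : Integrable (fun t => g t ^ 2 - 2 * c * g t) μ := i1.sub (i3.const_mul _)
    rw [e, integral_add j1 (integrable_const _),
      integral_sub i1 (i3.const_mul _), integral_const_mul, integral_const, smul_eq_mul]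
    ring
  have hpos : 0 < μ.real univ := lt_of_le_of_ne measureReal_nonneg (Ne.symm hμ)
  rw [key, key]
  set G := ∫ s, g s ∂μ
  have : G = (G / μ.real univ) * μ.real univ := by field_simp
  set m := G / μ.real univ
  rw [this]
  nlinarith [mul_nonneg hpos.le (sq_nonneg (m - d))]

theorem sq_integral_mul_le (hh : MemLp h 2 μ) (hg : MemLp g 2 μ) :
    (∫ t, h t * g t ∂μ) ^ 2 ≤ (∫ t, h t ^ 2 ∂μ) * ∫ t, g t ^ 2 ∂μ := by
  have i1 : Integrable (fun t => h t * g t) μ := hh.integrable_mul hg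
  have i2 : Integrable (fun t => h t ^ 2) μ := hh.integrable_sq
  have i3 : Integrable (fun t => g t ^ 2) μ := hg.integrable_sq
  -- The quadratic `s ↦ ∫ (h + s g)²` is nonnegative; its discriminant gives Cauchy–Schwarz.
  have key : ∀ s : ℝ, 0 ≤ (∫ t, g t ^ 2 ∂μ) * (s * s) + (2 * ∫ t, h t * g t ∂μ) * s
      + ∫ t, h t ^ 2 ∂μ := by
    intro s
    have e : (fun t => (h t + s * g t) ^ 2)
        = fun t => s * s * g t ^ 2 + 2 * s * (h t * g t) + h t ^ 2 := by
      ext t; ring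
    have h0 : 0 ≤ ∫ t, (h t + s * g t) ^ 2 ∂μ := integral_nonneg fun t => sq_nonneg _
    have j1 : Integrable (fun t => s * s * g t ^ 2 + 2 * s * (h t * g t)) μ :=
      (i3.const_mul _).add (i1.const_mul _)
    rw [e, integral_add j1 i2,
      integral_add (i3.const_mul _) (i1.const_mul _), integral_const_mul,
      integral_const_mul] at h0
    linarith
  have := discrim_le_zero key
  rw [discrim] at this
  nlinarith

/-- The Cauchy–Schwarz bound for the Chebyshev functional. -/
theorem abs_chebyshev_le_of_integral_sq_le [IsFiniteMeasure μ] (hμ : μ.real univ ≠ 0) (hh : MemLp h 2 μ)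
    (hg : MemLp g 2 μ) {c d A B : ℝ} (hA : 0 ≤ A) (hB : 0 ≤ B)
    (hcA : ∫ t, (h t - c) ^ 2 ∂μ ≤ A ^ 2) (hdB : ∫ t, (g t - d) ^ 2 ∂μ ≤ B ^ 2) :
    |∫ t, h t * g t ∂μ - (∫ t, h t ∂μ) * (∫ t, g t ∂μ) / μ.real univ| ≤ A * B := by
  rw [← integral_sub_mul_sub_average hμ hh hg c]
  apply abs_le_of_sq_le_sq _ (mul_nonneg hA hB)
  refine (sq_integral_mul_le (hh.sub (memLp_const c)) (hg.sub (memLp_const _))).trans ?_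
  rw [mul_pow]
  exact mul_le_mul hcA ((integral_sq_sub_average_le hμ hg d).trans hdB)
    (integral_nonneg fun t => sq_nonneg _) (sq_nonneg A)

theorem integral_sq_sub_midpoint_le [IsFiniteMeasure μ] {m M : ℝ} (hg : MemLp g 2 μ)
    (hb : ∀ᵐ t ∂μ, m ≤ g t ∧ g t ≤ M) :
    ∫ t, (g t - (m + M) / 2) ^ 2 ∂μ ≤ (Real.sqrt (μ.real univ) * ((M - m) / 2)) ^ 2 := by
  rw [mul_pow, Real.sq_sqrt measureReal_nonneg, ← smul_eq_mul, ← integral_const]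
  refine integral_mono_ae (hg.sub (memLp_const _)).integrable_sq (integrable_const _) ?_
  filter_upwards [hb] with t ht
  -- This is `(g - m) (M - g) ≥ 0`.
  nlinarith [ht.1, ht.2]

/-- The Grüss inequality. -/
theorem abs_chebyshev_le_gruss [IsFiniteMeasure μ] (hμ : μ.real univ ≠ 0) (hh : MemLp h 2 μ) (hg : MemLp g 2 μ)
    {m M m' M' : ℝ} (hm : m ≤ M) (hm' : m' ≤ M') (hb : ∀ᵐ t ∂μ, m ≤ h t ∧ h t ≤ M)
    (hb' : ∀ᵐ t ∂μ, m' ≤ g t ∧ g t ≤ M') :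
    |∫ t, h t * g t ∂μ - (∫ t, h t ∂μ) * (∫ t, g t ∂μ) / μ.real univ|
      ≤ μ.real univ / 4 * (M - m) * (M' - m') := by
  have := abs_chebyshev_le_of_integral_sq_le hμ hh hg
    (mul_nonneg (Real.sqrt_nonneg _) (by linarith)) (mul_nonneg (Real.sqrt_nonneg _) (by linarith))
    (integral_sq_sub_midpoint_le hh hb) (integral_sq_sub_midpoint_le hg hb')
  refine this.trans_eq ?_
  linear_combination ((M - m) * (M' - m') / 4) * Real.mul_self_sqrt (measureReal_nonneg (μ := μ) (s := univ))

/-- Values of `h` are attained on `s` with density at least `1 / K`, as for a `K`-Lipschitz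
function on an interval. -/
def HasValueDensity (μ : Measure α) (s : Set α) (K : ℝ) (h : α → ℝ) : Prop :=
  ∀ y ∈ s, ∀ z ∈ s, ∀ p q : ℝ, h y ≤ p → p < q → q ≤ h z →
    q - p ≤ K * μ.real {t | p < h t ∧ h t < q}

theorem HasValueDensity.neg {s : Set α} {K : ℝ} (hd : HasValueDensity μ s K h) :
    HasValueDensity μ s K (fun t => -h t) := by
  intro y hy z hz p q hp hpq hq
  have := hd z hz y hy (-q) (-p) (by linarith) (by linarith) (by linarith)
  have e : {t | p < -h t ∧ -h t < q} = {t | -q < h t ∧ h t < -p} := by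
    ext t; simp only [mem_ofPred_eq]; constructor <;> rintro ⟨h1, h2⟩ <;> constructor <;> linarith
  rw [e]; linarith

/-- To reach height `c + r`, `h` must spend measure `r / K` between `c` and `c + r`. So the set
where `h - c ≥ r` has measure at most `A - r / K`, and the layer-cake formula integrates this over
`0 < r < K A`. -/
theorem HasValueDensity.integral_posPart_le [IsFiniteMeasure μ] {s : Set α} {K : ℝ} (hd : HasValueDensity μ s K h)
    (hK : 0 ≤ K) (hs : ∀ᵐ t ∂μ, t ∈ s) (hm : Measurable h) (hi : Integrable h μ) {c : ℝ}
    (hc : ∃ y ∈ s, h y ≤ c) :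
    ∫ t, max (h t - c) 0 ∂μ ≤ K * (μ.real {t | c < h t}) ^ 2 / 2 := by
  obtain ⟨y, hy, hyc⟩ := hc
  set A := μ.real {t | c < h t} with hA
  have key : ∀ z ∈ s, ∀ r, 0 < r → r ≤ h z - c →
      r ≤ K * (A - μ.real {t | r ≤ max (h t - c) 0}) := by
    intro z hz r hr hrz
    have h1 := hd y hy z hz c (c + r) hyc (by linarith) (by linarith)
    refine (by linarith : r ≤ c + r - c).trans (h1.trans (mul_le_mul_of_nonneg_left ?_ hK))
    have hdis : Disjoint {t | c < h t ∧ h t < c + r} {t | r ≤ max (h t - c) 0} := by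
      rw [Set.disjoint_left]
      rintro t ⟨_, h2⟩ h3
      rcases le_max_iff.1 (show r ≤ max (h t - c) 0 from h3) with h3 | h3 <;> linarith
    have hmeas : MeasurableSet {t | r ≤ max (h t - c) 0} :=
      measurableSet_le measurable_const ((hm.sub_const c).max measurable_const)
    rw [le_sub_iff_add_le, ← measureReal_union hdis hmeas]
    refine measureReal_mono ?_
    rintro t (h2 | h2)
    · exact h2.1
    · rcases le_max_iff.1 (show r ≤ max (h t - c) 0 from h2) with h3 | h3
      · show c < h t
        linarith
      · linarith
  have hbd : ∀ᵐ t ∂μ, max (h t - c) 0 ≤ K * A := by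
    filter_upwards [hs] with t ht
    refine max_le ?_ (mul_nonneg hK measureReal_nonneg)
    by_contra! hcon
    have hKA : 0 ≤ K * A := mul_nonneg hK measureReal_nonneg
    have := key t ht (h t - c) (by linarith) le_rfl
    have h4 := mul_nonneg hK (measureReal_nonneg (μ := μ) (s := {x | h t - c ≤ max (h x - c) 0}))
    linarith
  rcases hK.eq_or_lt with rfl | hKpos
  · have : ∫ t, max (h t - c) 0 ∂μ ≤ ∫ _, (0 : ℝ) ∂μ := by
      refine integral_mono_ae (hi.sub (integrable_const c)).pos_part (integrable_const _) ?_
      filter_upwards [hbd] with t ht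
      simpa using ht
    simpa using this
  have hint : Integrable (fun t => max (h t - c) 0) μ := (hi.sub (integrable_const c)).pos_part
  rw [hint.integral_eq_integral_Ioc_meas_le (Filter.Eventually.of_forall fun t => le_max_right _ _)
    hbd, ← intervalIntegral.integral_of_le (by positivity)]
  have hanti : AntitoneOn (fun r => μ.real {t | r ≤ max (h t - c) 0}) (uIcc 0 (K * A)) := by
    intro r _ r' _ hr
    exact measureReal_mono fun t ht => le_trans hr ht
  calc ∫ r in (0 : ℝ)..K * A, μ.real {t | r ≤ max (h t - c) 0}
      ≤ ∫ r in (0 : ℝ)..K * A, (A - r / K) := by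
        refine intervalIntegral.integral_mono_on_of_le_Ioo (by positivity)
          hanti.intervalIntegrable (Continuous.intervalIntegrable (by fun_prop) _ _) ?_
        intro r hr
        by_cases hex : ∃ z ∈ s, r ≤ h z - c
        · obtain ⟨z, hz, hrz⟩ := hex
          have := key z hz r hr.1 hrz
          rw [← div_le_iff₀' hKpos] at this
          linarith
        -- No point of `s` reaches level `c + r`: the superlevel set is null, and `r ≤ K A` is
        -- enough.
        · push Not at hex
          have h0 : μ.real {t | r ≤ max (h t - c) 0} = 0 := by
            rw [measureReal_eq_zero_iff, measure_eq_zero_iff_ae_notMem]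
            filter_upwards [hs] with t ht hr'
            rcases le_max_iff.1 (show r ≤ max (h t - c) 0 from hr') with h3 | h3
            · linarith [hex t ht]
            · linarith [hr.1]
          rw [h0, sub_nonneg, div_le_iff₀ hKpos]
          linarith [hr.2]
    _ = K * A ^ 2 / 2 := by
        rw [intervalIntegral.integral_sub (by simp) (Continuous.intervalIntegrable (by fun_prop) _ _)]
        simp only [intervalIntegral.integral_const, intervalIntegral.integral_div, integral_id, smul_eq_mul]
        field_simp
        ring

/-- A function whose values have density at least `1 / K` deviates from its mean by at most
`K / 4` times the total mass squared. -/
theorem HasValueDensity.integral_abs_sub_average_le [IsFiniteMeasure μ] {s : Set α} {K : ℝ}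
    (hd : HasValueDensity μ s K h) (hK : 0 ≤ K) (hs : ∀ᵐ t ∂μ, t ∈ s) (hm : Measurable h)
    (hi : Integrable h μ) (hμ : μ.real univ ≠ 0) :
    ∫ t, |h t - (∫ s, h s ∂μ) / μ.real univ| ∂μ ≤ K * μ.real univ ^ 2 / 4 := by
  set c := (∫ s, h s ∂μ) / μ.real univ with hc
  have hμ0 : μ ≠ 0 := by rintro rfl; simp at hμ
  have havg : ⨍ t, h t ∂μ = c := by
    rw [average_eq, smul_eq_mul, hc]; ring
  -- Value density only tests points of `s`, so the points on either side of the mean must be found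
  -- outside the null set `sᶜ`.
  have hN : μ sᶜ = 0 := hs
  obtain ⟨y, hy, hyc⟩ := exists_notMem_null_le_average hμ0 hi hN
  obtain ⟨z, hz, hzc⟩ := exists_notMem_null_average_le hμ0 hi hN
  rw [havg] at hyc hzc
  rw [notMem_compl_iff] at hy hz
  have h1 := hd.integral_posPart_le hK hs hm hi ⟨y, hy, hyc⟩
  have h2 := hd.neg.integral_posPart_le hK hs hm.neg hi.neg ⟨z, hz, neg_le_neg hzc⟩
  have i1 : Integrable (fun t => h t - c) μ := hi.sub (integrable_const c)
  have ip : Integrable (fun t => max (h t - c) 0) μ := i1.pos_part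
  have im : Integrable (fun t => max (-h t - -c) 0) μ :=
    (hi.neg.sub (integrable_const (-c))).pos_part
  have h0 : ∫ t, (h t - c) ∂μ = 0 := by
    rw [integral_sub hi (integrable_const c), integral_const, smul_eq_mul, hc]
    field_simp
    ring
  have e1 : ∫ t, |h t - c| ∂μ = ∫ t, max (h t - c) 0 ∂μ + ∫ t, max (-h t - -c) 0 ∂μ := by
    rw [← integral_add ip im]
    congr 1; ext t
    rcases le_total 0 (h t - c) with h3 | h3
    · rw [abs_of_nonneg h3, max_eq_left h3, max_eq_right (by linarith)]; ring
    · rw [abs_of_nonpos h3, max_eq_right h3, max_eq_left (by linarith)]; ring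
  have e2 : ∫ t, max (h t - c) 0 ∂μ = ∫ t, max (-h t - -c) 0 ∂μ := by
    rw [← sub_eq_zero, ← integral_sub ip im]
    refine Eq.trans ?_ h0
    refine integral_congr_ae (Filter.Eventually.of_forall fun t => ?_)
    show max (h t - c) 0 - max (-h t - -c) 0 = h t - c
    rcases le_total 0 (h t - c) with h3 | h3
    · rw [max_eq_left h3, max_eq_right (by linarith)]; ring
    · rw [max_eq_right h3, max_eq_left (by linarith)]; ring
  have hsum : μ.real {t | c < h t} + μ.real {t | -c < -h t} ≤ μ.real univ := by
    have hdis : Disjoint {t | c < h t} {t | -c < -h t} := by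
      rw [Set.disjoint_left]
      intro t (h3 : c < h t) (h4 : -c < -h t)
      linarith
    have hmeas : MeasurableSet {t | -c < -h t} := measurableSet_lt measurable_const hm.neg
    rw [← measureReal_union hdis hmeas]
    exact measureReal_mono (subset_univ _)
  have p1 : 0 ≤ μ.real {t | c < h t} := measureReal_nonneg
  have p2 : 0 ≤ μ.real {t | -c < -h t} := measureReal_nonneg
  set A := μ.real {t | c < h t}
  set B := μ.real {t | -c < -h t}
  -- The positive and negative parts have equal integrals, so the total is twice either one. The one
  -- living on the smaller set, of measure at most half the mass, gives the factor 1/4.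
  rcases le_total A B with hAB | hAB
  · have : A ^ 2 ≤ (μ.real univ / 2) ^ 2 := pow_le_pow_left₀ p1 (by linarith) 2
    nlinarith [mul_le_mul_of_nonneg_left this hK]
  · have : B ^ 2 ≤ (μ.real univ / 2) ^ 2 := pow_le_pow_left₀ p2 (by linarith) 2
    nlinarith [mul_le_mul_of_nonneg_left this hK]

/-- The Ostrowski bound for the Chebyshev functional. -/
theorem HasValueDensity.abs_chebyshev_le [IsFiniteMeasure μ] {s : Set α} {K m M : ℝ} (hd : HasValueDensity μ s K h)
    (hK : 0 ≤ K) (hs : ∀ᵐ t ∂μ, t ∈ s) (hm : Measurable h) (hμ : μ.real univ ≠ 0)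
    (hh : MemLp h 2 μ) (hg : MemLp g 2 μ) (hmM : m ≤ M) (hb : ∀ᵐ t ∂μ, m ≤ g t ∧ g t ≤ M) :
    |∫ t, g t * h t ∂μ - (∫ t, g t ∂μ) * (∫ t, h t ∂μ) / μ.real univ|
      ≤ μ.real univ ^ 2 / 8 * K * (M - m) := by
  have hi : Integrable h μ := hh.integrable (by norm_num)
  have h1 := hd.integral_abs_sub_average_le hK hs hm hi hμ
  rw [← integral_sub_mul_sub_average hμ hg hh ((m + M) / 2)]
  have i1 : Integrable (fun t => |h t - (∫ s, h s ∂μ) / μ.real univ|) μ :=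
    (hi.sub (integrable_const _)).abs
  calc |∫ t, (g t - (m + M) / 2) * (h t - (∫ s, h s ∂μ) / μ.real univ) ∂μ|
      ≤ ∫ t, (M - m) / 2 * |h t - (∫ s, h s ∂μ) / μ.real univ| ∂μ := by
        rw [← Real.norm_eq_abs]
        refine norm_integral_le_of_norm_le (i1.const_mul _) ?_
        filter_upwards [hb] with t ht
        rw [norm_mul, Real.norm_eq_abs, Real.norm_eq_abs]
        refine mul_le_mul_of_nonneg_right ?_ (abs_nonneg _)
        rw [abs_le]; constructor <;> linarith [ht.1, ht.2]
    _ ≤ μ.real univ ^ 2 / 8 * K * (M - m) := by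
        rw [integral_const_mul]
        nlinarith [mul_le_mul_of_nonneg_left h1 (by linarith : 0 ≤ (M - m) / 2)]

end Chebyshev

/-! ### Wirtinger's inequality with a zero at one endpoint -/

section Wirtinger

/-- With `w = r tan (r (b - t))`, one has `u'² - r² u² - (w u²)' = (u' - w u)² ≥ 0`. The boundary
terms of `w u²` vanish, by `tan 0 = 0` at `b` and `u a = 0` at `a`. The strict bound on `r` keeps
the tangent finite on `[a, b]`. -/
theorem mul_integral_sq_le_of_lt_pi_div_two {u u' : ℝ → ℝ} {a b r : ℝ} (hab : a ≤ b)
    (hr0 : 0 ≤ r) (hr : r * (b - a) < Real.pi / 2)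
    (hu : ∀ t ∈ Icc a b, HasDerivAt u (u' t) t) (hu' : ContinuousOn u' (Icc a b)) (h0 : u a = 0) :
    r ^ 2 * ∫ t in a..b, u t ^ 2 ≤ ∫ t in a..b, u' t ^ 2 := by
  have hcu : ContinuousOn u (Icc a b) := fun t ht => (hu t ht).continuousAt.continuousWithinAt
  have hcos : ∀ t ∈ Icc a b, Real.cos (r * (b - t)) ≠ 0 := by
    intro t ht
    refine (Real.cos_pos_of_mem_Ioo ⟨?_, ?_⟩).ne'
    · have := mul_nonneg hr0 (sub_nonneg.2 ht.2)
      linarith [Real.pi_pos]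
    · have : r * (b - t) ≤ r * (b - a) := mul_le_mul_of_nonneg_left (by linarith [ht.1]) hr0
      linarith
  have htan : ∀ t ∈ Icc a b, HasDerivAt (fun t => r * Real.tan (r * (b - t)))
      (-(r ^ 2 * (1 + Real.tan (r * (b - t)) ^ 2))) t := by
    intro t ht
    have h1 : HasDerivAt (fun t => r * (b - t)) (-r) t := by
      simpa using ((hasDerivAt_id t).const_sub b).const_mul r
    have h2 := ((Real.hasDerivAt_tan (hcos t ht)).comp t h1).const_mul r
    refine h2.congr_deriv ?_
    rw [← Real.inv_one_add_tan_sq (hcos t ht), one_div, inv_inv]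
    ring
  have hctan : ContinuousOn (fun t => Real.tan (r * (b - t))) (Icc a b) := by
    intro t ht
    have h1 : ContinuousAt (fun t => r * (b - t)) t := by fun_prop
    exact (ContinuousAt.comp (f := fun t => r * (b - t)) (x := t)
      (Real.continuousAt_tan.2 (hcos t ht)) h1).continuousWithinAt
  have hF : ∀ t ∈ uIcc a b, HasDerivAt (fun t => r * Real.tan (r * (b - t)) * u t ^ 2)
      (2 * (r * Real.tan (r * (b - t))) * u t * u' t
        - r ^ 2 * (1 + Real.tan (r * (b - t)) ^ 2) * u t ^ 2) t := by
    intro t ht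
    rw [uIcc_of_le hab] at ht
    refine ((htan t ht).mul ((hu t ht).pow 2)).congr_deriv ?_
    simp only [Nat.cast_ofNat, Nat.add_one_sub_one, pow_one, Pi.pow_apply]
    ring
  have i1 : IntervalIntegrable (fun t => 2 * (r * Real.tan (r * (b - t))) * u t * u' t
      - r ^ 2 * (1 + Real.tan (r * (b - t)) ^ 2) * u t ^ 2) volume a b := by
    apply ContinuousOn.intervalIntegrable
    rw [uIcc_of_le hab]
    fun_prop
  have i2 : IntervalIntegrable (fun t => u' t ^ 2) volume a b := by
    apply ContinuousOn.intervalIntegrable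
    rw [uIcc_of_le hab]
    fun_prop
  have i3 : IntervalIntegrable (fun t => r ^ 2 * u t ^ 2) volume a b := by
    apply ContinuousOn.intervalIntegrable
    rw [uIcc_of_le hab]
    fun_prop
  have hFTC := intervalIntegral.integral_eq_sub_of_hasDerivAt hF i1
  rw [sub_self, mul_zero, Real.tan_zero, h0] at hFTC
  have hle := intervalIntegral.integral_mono_on hab i1 (i2.sub i3) (fun t _ => by
    nlinarith [sq_nonneg (u' t - r * Real.tan (r * (b - t)) * u t)])
  rw [hFTC, intervalIntegral.integral_sub i2 i3, intervalIntegral.integral_const_mul] at hle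
  linarith

/-- Wirtinger's inequality for a function vanishing at the left endpoint. -/
theorem integral_sq_le_of_eq_zero_left {u u' : ℝ → ℝ} {a b : ℝ} (hab : a ≤ b)
    (hu : ∀ t ∈ Icc a b, HasDerivAt u (u' t) t) (hu' : ContinuousOn u' (Icc a b)) (h0 : u a = 0) :
    ∫ t in a..b, u t ^ 2 ≤ (2 * (b - a) / Real.pi) ^ 2 * ∫ t in a..b, u' t ^ 2 := by
  rcases hab.eq_or_lt with rfl | hlt
  · simp
  have hL : 0 < b - a := sub_pos.2 hlt
  set A := ∫ t in a..b, u t ^ 2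
  set B := ∫ t in a..b, u' t ^ 2
  set R := Real.pi / (2 * (b - a)) with hR
  have hRpos : 0 < R := div_pos Real.pi_pos (by linarith)
  have hlim : Filter.Tendsto (fun r : ℝ => r ^ 2 * A) (nhdsWithin R (Iio R)) (nhds (R ^ 2 * A)) :=
    (Continuous.tendsto (by fun_prop) R).mono_left nhdsWithin_le_nhds
  have key : R ^ 2 * A ≤ B := by
    -- The tangent blows up at the critical `R`, so the sharp constant is reached as a limit from
    -- below.
    refine le_of_tendsto hlim ?_
    filter_upwards [Ioo_mem_nhdsLT hRpos] with r hr
    refine mul_integral_sq_le_of_lt_pi_div_two hab hr.1.le ?_ hu hu' h0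
    calc r * (b - a) < R * (b - a) := mul_lt_mul_of_pos_right hr.2 hL
      _ = Real.pi / 2 := by rw [hR]; field_simp
  have hinv : (2 * (b - a) / Real.pi) = R⁻¹ := by rw [hR, inv_div]
  rw [hinv, inv_pow, inv_mul_eq_div, le_div_iff₀ (by positivity)]
  linarith

/-- Wirtinger's inequality for a function vanishing at the right endpoint. -/
theorem integral_sq_le_of_eq_zero_right {u u' : ℝ → ℝ} {a b : ℝ} (hab : a ≤ b)
    (hu : ∀ t ∈ Icc a b, HasDerivAt u (u' t) t) (hu' : ContinuousOn u' (Icc a b)) (h0 : u b = 0) :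
    ∫ t in a..b, u t ^ 2 ≤ (2 * (b - a) / Real.pi) ^ 2 * ∫ t in a..b, u' t ^ 2 := by
  have hmem : ∀ t ∈ Icc (-b) (-a), -t ∈ Icc a b := fun t ht =>
    ⟨by linarith [ht.2], by linarith [ht.1]⟩
  have h := integral_sq_le_of_eq_zero_left (u := fun t => u (-t)) (u' := fun t => -u' (-t))
    (neg_le_neg hab)
    (fun t ht => by
      simpa [Function.comp_def] using (hu (-t) (hmem t ht)).comp t (hasDerivAt_neg t))
    ((hu'.comp continuousOn_neg hmem).neg) (by simpa using h0)
  simp only [neg_sq] at h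
  rw [intervalIntegral.integral_comp_neg (fun t => u t ^ 2),
    intervalIntegral.integral_comp_neg (fun t => u' t ^ 2)] at h
  simp only [neg_neg] at h
  convert h using 3
  ring

end Wirtinger

/-! ### Value density of Lipschitz and of pinned piecewise Lipschitz functions -/

section ValueDensity

/-- By the intermediate value theorem the image of the set covers `(p, q)`, and a `K`-Lipschitz map
enlarges one-dimensional Hausdorff measure at most `K` times. The endpoints take no value in `(p,
q)`, so the open interval suffices. -/
theorem sub_le_mul_volume_of_lipschitz {u : ℝ → ℝ} {K y e p q : ℝ} (hK : 0 ≤ K)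
    (hL : ∀ s ∈ uIcc y e, ∀ t ∈ uIcc y e, |u s - u t| ≤ K * |s - t|)
    (hp : u y ≤ p ∧ q ≤ u e ∨ u e ≤ p ∧ q ≤ u y) :
    q - p ≤ K * volume.real {t | t ∈ uIoo y e ∧ p < u t ∧ u t < q} := by
  set A := {t | t ∈ uIoo y e ∧ p < u t ∧ u t < q} with hA
  have hAsub : A ⊆ uIcc y e := fun t ht => uIoo_subset_uIcc_self ht.1
  have hlip : LipschitzOnWith K.toNNReal u (uIcc y e) :=
    LipschitzOnWith.of_dist_le_mul fun s hs t ht => by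
      rw [Real.coe_toNNReal K hK, Real.dist_eq, Real.dist_eq]
      exact hL s hs t ht
  have himg : Ioo p q ⊆ u '' A := by
    intro v hv
    have hv' : v ∈ uIcc (u y) (u e) := by
      rcases hp with hp | hp
      · exact mem_uIcc.2 (Or.inl ⟨hp.1.trans hv.1.le, hv.2.le.trans hp.2⟩)
      · exact mem_uIcc.2 (Or.inr ⟨hp.1.trans hv.1.le, hv.2.le.trans hp.2⟩)
    obtain ⟨t, ht, rfl⟩ := intermediate_value_uIcc hlip.continuousOn hv'
    have hy : t ≠ y := by
      rintro rfl
      rcases hp with hp | hp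
      · exact absurd hv.1 (not_lt.2 hp.1)
      · exact absurd hv.2 (not_lt.2 hp.2)
    have he : t ≠ e := by
      rintro rfl
      rcases hp with hp | hp
      · exact absurd hv.2 (not_lt.2 hp.2)
      · exact absurd hv.1 (not_lt.2 hp.1)
    refine ⟨t, ⟨?_, hv⟩, rfl⟩
    rcases mem_uIcc.1 ht with ht | ht
    · exact mem_uIoo_of_lt (lt_of_le_of_ne ht.1 hy.symm) (lt_of_le_of_ne ht.2 he)
    · exact mem_uIoo_of_gt (lt_of_le_of_ne ht.1 he.symm) (lt_of_le_of_ne ht.2 hy)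
  have hmeas : volume (u '' A) ≤ (K.toNNReal : ENNReal) * volume A := by
    have := (hlip.mono hAsub).hausdorffMeasure_image_le (zero_le_one (α := ℝ))
    rwa [hausdorffMeasure_real, ENNReal.rpow_one] at this
  have hfin : volume A ≠ ⊤ := measure_ne_top_of_subset hAsub (by rw [uIcc]; simp)
  have h1 : ENNReal.ofReal (q - p) ≤ (K.toNNReal : ENNReal) * volume A := by
    rw [← Real.volume_Ioo]; exact (measure_mono himg).trans hmeas
  have h2 := ENNReal.toReal_mono (ENNReal.mul_ne_top ENNReal.coe_ne_top hfin) h1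
  rw [ENNReal.toReal_mul, ENNReal.coe_toReal, Real.coe_toNNReal K hK,
    ENNReal.toReal_ofReal'] at h2
  exact (le_max_left _ _).trans h2

theorem sub_le_mul_restrict_of_eqOn {h u : ℝ → ℝ} {K a b y e p q : ℝ} (hK : 0 ≤ K)
    (hy : y ∈ Icc a b) (he : e ∈ Icc a b) (hhu : EqOn h u (uIoo y e))
    (hL : ∀ s ∈ uIcc y e, ∀ t ∈ uIcc y e, |u s - u t| ≤ K * |s - t|)
    (hp : u y ≤ p ∧ q ≤ u e ∨ u e ≤ p ∧ q ≤ u y) :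
    q - p ≤ K * (volume.restrict (Icc a b)).real {t | p < h t ∧ h t < q} := by
  refine (sub_le_mul_volume_of_lipschitz hK hL hp).trans (mul_le_mul_of_nonneg_left ?_ hK)
  rw [measureReal_restrict_apply' measurableSet_Icc]
  refine measureReal_mono (fun t ht => ⟨?_, ?_⟩)
    (measure_ne_top_of_subset inter_subset_right (by simp))
  · show p < h t ∧ h t < q
    rw [hhu ht.1]; exact ht.2
  · exact uIcc_subset_Icc hy he (uIoo_subset_uIcc_self ht.1)

theorem hasValueDensity_of_lipschitz {h : ℝ → ℝ} {K a b : ℝ} (hK : 0 ≤ K)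
    (hL : ∀ s ∈ Icc a b, ∀ t ∈ Icc a b, |h s - h t| ≤ K * |s - t|) :
    HasValueDensity (volume.restrict (Icc a b)) (Icc a b) K h := by
  intro y hy z hz p q hp _ hq
  have hsub := uIcc_subset_Icc hy hz
  exact sub_le_mul_restrict_of_eqOn hK hy hz (fun t _ => rfl)
    (fun s hs t ht => hL s (hsub hs) t (hsub ht)) (Or.inl ⟨hp, hq⟩)

/-- A function that is piecewise Lipschitz, each piece vanishing at one of its ends, has the value
density of a Lipschitz function, in spite of its jumps. -/
theorem hasValueDensity_of_pinned {h : ℝ → ℝ} {K a b : ℝ} (hK : 0 ≤ K) (hm : Measurable h)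
    (hpin : ∀ y ∈ Icc a b, ∃ e ∈ Icc a b, ∃ u : ℝ → ℝ, u e = 0 ∧ u y = h y ∧
      EqOn h u (uIoo y e) ∧
      ∀ s ∈ uIcc y e, ∀ t ∈ uIcc y e, |u s - u t| ≤ K * |s - t|) :
    HasValueDensity (volume.restrict (Icc a b)) (Icc a b) K h := by
  have hneg : ∀ y ∈ Icc a b, ∀ p q, h y ≤ p → q ≤ 0 →
      q - p ≤ K * (volume.restrict (Icc a b)).real {t | p < h t ∧ h t < q} := by
    intro y hy p q hp hq
    obtain ⟨e, he, u, hue, huy, hhu, hL⟩ := hpin y hy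
    exact sub_le_mul_restrict_of_eqOn hK hy he hhu hL
      (Or.inl ⟨huy.trans_le hp, hq.trans_eq hue.symm⟩)
  have hpos : ∀ z ∈ Icc a b, ∀ p q, 0 ≤ p → q ≤ h z →
      q - p ≤ K * (volume.restrict (Icc a b)).real {t | p < h t ∧ h t < q} := by
    intro z hz p q hp hq
    obtain ⟨e, he, u, hue, huz, hhu, hL⟩ := hpin z hz
    exact sub_le_mul_restrict_of_eqOn hK hz he hhu hL
      (Or.inr ⟨hue.trans_le hp, hq.trans_eq huz.symm⟩)
  intro y hy z hz p q hp hpq hq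
  rcases le_total q 0 with hq0 | hq0
  · exact hneg y hy p q hp hq0
  rcases le_total 0 p with hp0 | hp0
  · exact hpos z hz p q hp0 hq
  -- When `p ≤ 0 ≤ q`, the range is split at the common value 0: the piece of `y` covers `(p, 0)`
  -- and the piece of `z` covers `(0, q)`. The two level sets are disjoint, so their measures add.
  have h1 := hneg y hy p 0 hp le_rfl
  have h2 := hpos z hz 0 q le_rfl hq
  have hdis : Disjoint {t | p < h t ∧ h t < 0} {t | 0 < h t ∧ h t < q} := by
    rw [Set.disjoint_left]
    intro t ⟨_, h3⟩ ⟨h4, _⟩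
    linarith
  have hmeas : MeasurableSet {t | 0 < h t ∧ h t < q} := hm measurableSet_Ioo
  have hsub : {t | p < h t ∧ h t < 0} ∪ {t | 0 < h t ∧ h t < q} ⊆ {t | p < h t ∧ h t < q} := by
    rintro t (⟨h3, h4⟩ | ⟨h3, h4⟩)
    · exact ⟨h3, h4.trans_le hq0⟩
    · exact ⟨lt_of_le_of_lt hp0 h3, h4⟩
  have h3 := mul_le_mul_of_nonneg_left
    (measureReal_mono (μ := volume.restrict (Icc a b)) hsub) hK
  rw [measureReal_union hdis hmeas] at h3
  linarith

end ValueDensity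

/-! ### The kernel and its three affine pieces -/

section Kernel

variable {a b x : ℝ}

theorem kernelS_eqOn_left : EqOn (kernelS a b x) (fun t => t - a) (Iic x) := by
  intro t ht
  simp [kernelS, mem_Iic.1 ht]

theorem kernelS_eqOn_middle :
    EqOn (kernelS a b x) (fun t => t - (a + b) / 2) (Ioo x (a + b - x)) := by
  intro t ht
  simp [kernelS, not_le.2 ht.1, ht.2]

theorem kernelS_eq_right {t : ℝ} (hxt : x < t) (ht : a + b - x ≤ t) : kernelS a b x t = t - b := by
  simp [kernelS, not_le.2 hxt, not_lt.2 ht]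

theorem measurable_kernelS : Measurable (kernelS a b x) :=
  Measurable.ite measurableSet_Iic (by fun_prop)
    (Measurable.ite measurableSet_Iio (by fun_prop) (by fun_prop))

theorem abs_kernelS_le (hx : x ∈ Icc a ((a + b) / 2)) {t : ℝ} (ht : t ∈ Icc a b) :
    |kernelS a b x t| ≤ b - a := by
  obtain ⟨h1, h2⟩ := hx
  obtain ⟨h3, h4⟩ := ht
  unfold kernelS
  split_ifs with h5 h6 <;> rw [abs_le] <;> constructor <;> linarith

theorem intervalIntegrable_and_integral_comp_kernelS (hx : x ∈ Icc a ((a + b) / 2))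
    {G : ℝ → ℝ → ℝ} (hG : Continuous fun z : ℝ × ℝ => G z.1 z.2) :
    IntervalIntegrable (fun t => G t (kernelS a b x t)) volume a b ∧
    ∫ t in a..b, G t (kernelS a b x t) = (∫ t in a..x, G t (t - a))
      + (∫ t in x..(a + b - x), G t (t - (a + b) / 2)) + ∫ t in (a + b - x)..b, G t (t - b) := by
  obtain ⟨hax, hxm⟩ := hx
  have hxy : x ≤ a + b - x := by linarith
  have hyb : a + b - x ≤ b := by linarith
  have hcont : ∀ e c d : ℝ, IntervalIntegrable (fun t => G t (t - e)) volume c d := fun e c d =>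
    (hG.comp (continuous_id.prodMk (continuous_id.sub continuous_const))).intervalIntegrable c d
  have e1 : EqOn (fun t => G t (t - a)) (fun t => G t (kernelS a b x t)) (uIoo a x) := by
    intro t ht
    rw [uIoo_of_le hax] at ht
    simp only [kernelS_eqOn_left ht.2.le]
  have e2 : EqOn (fun t => G t (t - (a + b) / 2)) (fun t => G t (kernelS a b x t))
      (uIoo x (a + b - x)) := by
    intro t ht
    rw [uIoo_of_le hxy] at ht
    simp only [kernelS_eqOn_middle ht]
  have e3 : EqOn (fun t => G t (t - b)) (fun t => G t (kernelS a b x t)) (uIoo (a + b - x) b) := by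
    intro t ht
    rw [uIoo_of_le hyb] at ht
    simp only [kernelS_eq_right (hxy.trans_lt ht.1) ht.1.le]
  have i1 := (hcont a a x).congr_uIoo e1
  have i2 := (hcont ((a + b) / 2) x (a + b - x)).congr_uIoo e2
  have i3 := (hcont b (a + b - x) b).congr_uIoo e3
  refine ⟨(i1.trans i2).trans i3, ?_⟩
  rw [← intervalIntegral.integral_add_adjacent_intervals (i1.trans i2) i3,
    ← intervalIntegral.integral_add_adjacent_intervals i1 i2,
    intervalIntegral.integral_congr_uIoo e1, intervalIntegral.integral_congr_uIoo e2,
    intervalIntegral.integral_congr_uIoo e3]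

theorem integral_Icc_comp_kernelS (hab : a ≤ b) (hx : x ∈ Icc a ((a + b) / 2))
    {G : ℝ → ℝ → ℝ} (hG : Continuous fun z : ℝ × ℝ => G z.1 z.2) :
    ∫ t in Icc a b, G t (kernelS a b x t) = (∫ t in a..x, G t (t - a))
      + (∫ t in x..(a + b - x), G t (t - (a + b) / 2)) + ∫ t in (a + b - x)..b, G t (t - b) := by
  rw [integral_Icc_eq_integral_Ioc, ← intervalIntegral.integral_of_le hab,
    (intervalIntegrable_and_integral_comp_kernelS hx hG).2]

end Kernel

/-! ### Norms on `[a, b]` -/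

section Norms

variable {a b : ℝ} {v : ℝ → ℝ}

theorem memLp_of_bounded {p : ENNReal} (hv : Measurable v) {C : ℝ} (hC : ∀ t ∈ Icc a b, |v t| ≤ C) :
    MemLp v p (volume.restrict (Icc a b)) :=
  MemLp.of_bound hv.aestronglyMeasurable C ((ae_restrict_iff' measurableSet_Icc).2
    (Filter.Eventually.of_forall fun t ht => hC t ht))

theorem memLp_of_continuousOn {p : ENNReal} (hv : ContinuousOn v (Icc a b)) :
    MemLp v p (volume.restrict (Icc a b)) := by
  obtain ⟨C, hC⟩ := isCompact_Icc.exists_bound_of_continuousOn hv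
  exact MemLp.of_bound (hv.aestronglyMeasurable measurableSet_Icc) C
    ((ae_restrict_iff' measurableSet_Icc).2 (Filter.Eventually.of_forall fun t ht => hC t ht))

theorem normOn_nonneg {p : ENNReal} : 0 ≤ normOn a b p v := ENNReal.toReal_nonneg

theorem ae_abs_le_normOn_top (hv : MemLp v ⊤ (volume.restrict (Icc a b))) :
    ∀ᵐ t ∂volume.restrict (Icc a b), |v t| ≤ normOn a b ⊤ v := by
  have hfin : eLpNormEssSup v (volume.restrict (Icc a b)) ≠ ⊤ := by
    rw [← eLpNorm_exponent_top]; exact hv.2.ne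
  filter_upwards [ae_le_eLpNormEssSup (f := v) (μ := volume.restrict (Icc a b))] with t ht
  have := ENNReal.toReal_mono hfin ht
  rwa [toReal_enorm, Real.norm_eq_abs, ← eLpNorm_exponent_top] at this

theorem normOn_two_sq (hab : a ≤ b) (hv : MemLp v 2 (volume.restrict (Icc a b))) :
    normOn a b 2 v ^ 2 = ∫ t in a..b, v t ^ 2 := by
  have h0 : 0 ≤ ∫ t in Icc a b, v t ^ 2 := integral_nonneg fun t => sq_nonneg _
  rw [normOn, hv.eLpNorm_eq_integral_rpow_norm (by norm_num) (by norm_num),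
    intervalIntegral.integral_of_le hab, ← integral_Icc_eq_integral_Ioc]
  simp only [ENNReal.toReal_ofNat, Real.rpow_ofNat, Real.norm_eq_abs, sq_abs]
  rw [ENNReal.toReal_ofReal (Real.rpow_nonneg h0 _), ← Real.rpow_natCast, ← Real.rpow_mul h0]
  norm_num

end Norms

/-! ### Estimates on a single piece -/

section Pieces

variable {u u' v : ℝ → ℝ} {a b c d K : ℝ}

/-- Agreement of `v` with `u'` on the open piece is enough, since endpoints are null. This lets `v`
be `qDS`, whose value at a jump may belong to the neighbouring branch. -/
theorem abs_sub_le_of_ae_abs_deriv_le (hu : ∀ t ∈ Icc c d, HasDerivAt u (u' t) t)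
    (hu' : ContinuousOn u' (Icc c d)) (hsub : Icc c d ⊆ Icc a b) (hv : EqOn v u' (Ioo c d))
    (hK : ∀ᵐ t ∂volume.restrict (Icc a b), |v t| ≤ K) :
    ∀ s ∈ Icc c d, ∀ t ∈ Icc c d, |u s - u t| ≤ K * |s - t| := by
  intro s hs t ht
  have hts : uIcc t s ⊆ Icc c d := uIcc_subset_Icc ht hs
  rw [← intervalIntegral.integral_eq_sub_of_hasDerivAt (fun r hr => hu r (hts hr))
    (hu'.mono hts).intervalIntegrable, ← Real.norm_eq_abs]
  refine intervalIntegral.norm_integral_le_of_norm_le_const_ae ?_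
  filter_upwards [(ae_restrict_iff' measurableSet_Icc).1 hK, Measure.ae_ne volume c,
    Measure.ae_ne volume d] with r hr hrc hrd hmem
  have hr' := hts (uIoc_subset_uIcc hmem)
  rw [Real.norm_eq_abs, ← hv ⟨lt_of_le_of_ne hr'.1 hrc.symm, lt_of_le_of_ne hr'.2 hrd⟩]
  exact hr (hsub hr')

theorem integral_sq_le_of_abs_le_mul {e : ℝ} (hcd : c ≤ d) (hu : ContinuousOn u (Icc c d))
    (hK : ∀ t ∈ Icc c d, |u t| ≤ K * |t - e|) :
    ∫ t in c..d, u t ^ 2 ≤ K ^ 2 * ((d - e) ^ 3 - (c - e) ^ 3) / 3 := by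
  have hFTC : ∫ t in c..d, K ^ 2 * (t - e) ^ 2 = K ^ 2 * ((d - e) ^ 3 - (c - e) ^ 3) / 3 := by
    rw [intervalIntegral.integral_const_mul,
      intervalIntegral.integral_comp_sub_right (fun t => t ^ 2), integral_pow]
    norm_num
    ring
  rw [← hFTC]
  refine intervalIntegral.integral_mono_on hcd ?_ (Continuous.intervalIntegrable (by fun_prop) _ _) ?_
  · apply ContinuousOn.intervalIntegrable
    rw [uIcc_of_le hcd]
    fun_prop
  · intro t ht
    rw [← sq_abs, ← sq_abs (t - e), ← mul_pow]
    exact pow_le_pow_left₀ (abs_nonneg _) (hK t ht) 2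

end Pieces

/-! ### The function `Q_{n-1} S` for a harmonic sequence -/

section Harmonic

variable {a b x : ℝ} {Q : ℕ → Polynomial ℝ} {m : ℕ}

theorem IsHarmonicSeq.hasDerivAt (hQ : IsHarmonicSeq Q) (k : ℕ) (t : ℝ) :
    HasDerivAt (fun t => (Q (k + 1)).eval t) ((Q k).eval t) t := by
  rw [← hQ.2 k]; exact (Q (k + 1)).hasDerivAt t

theorem IsHarmonicSeq.hasDerivAt_mul_sub (hQ : IsHarmonicSeq Q) (k : ℕ) (e t : ℝ) :
    HasDerivAt (fun t => (Q (k + 1)).eval t * (t - e))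
      ((Q (k + 1)).eval t + (Q k).eval t * (t - e)) t :=
  ((hQ.hasDerivAt k t).mul ((hasDerivAt_id t).sub_const e)).congr_deriv (by simp; ring)

theorem IsHarmonicSeq.integral_mul_sub (hQ : IsHarmonicSeq Q) (k : ℕ) (e c d : ℝ) :
    ∫ t in c..d, (Q k).eval t * (t - e)
      = ((Q (k + 1)).eval d * (d - e) - (Q (k + 2)).eval d)
        - ((Q (k + 1)).eval c * (c - e) - (Q (k + 2)).eval c) := by
  refine intervalIntegral.integral_eq_sub_of_hasDerivAt
    (f := fun t => (Q (k + 1)).eval t * (t - e) - (Q (k + 2)).eval t) (fun t _ => ?_)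
    (Continuous.intervalIntegrable (by fun_prop) _ _)
  exact ((hQ.hasDerivAt_mul_sub k e t).sub (hQ.hasDerivAt (k + 1) t)).congr_deriv (by ring)

/-- On each piece `Q_{m+2}(t) (t - e) - Q_{m+3}(t)` is a primitive. The `Q_{m+3}` terms telescope,
and at `x` and `a + b - x` the factors `t - e` of the adjacent pieces differ by `(b - a) / 2`. -/
theorem integral_qS (hQ : IsHarmonicSeq Q) (hab : a ≤ b) (hx : x ∈ Icc a ((a + b) / 2)) :
    ∫ t in Icc a b, qS a b Q (m + 2) x t
      = (b - a) * (((Q (m + 2)).eval x + (Q (m + 2)).eval (a + b - x)) / 2)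
        - ((Q (m + 3)).eval b - (Q (m + 3)).eval a) := by
  refine (integral_Icc_comp_kernelS hab hx (G := fun t s => (Q (m + 1)).eval t * s)
    (by fun_prop)).trans ?_
  rw [hQ.integral_mul_sub, hQ.integral_mul_sub, hQ.integral_mul_sub]
  ring

theorem measurable_qS : Measurable (qS a b Q (m + 2) x) :=
  (Q (m + 1)).continuous.measurable.mul measurable_kernelS

theorem measurable_qDS : Measurable (qDS a b Q (m + 2) x) :=
  (Q (m + 1)).continuous.measurable.add ((Q m).continuous.measurable.mul measurable_kernelS)

theorem exists_abs_qS_le (hx : x ∈ Icc a ((a + b) / 2)) :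
    ∃ C, ∀ t ∈ Icc a b, |qS a b Q (m + 2) x t| ≤ C := by
  obtain ⟨C, hC⟩ := isCompact_Icc.exists_bound_of_continuousOn
    (s := Icc a b) (Q (m + 1)).continuous.continuousOn
  refine ⟨C * (b - a), fun t ht => ?_⟩
  show |(Q (m + 1)).eval t * kernelS a b x t| ≤ _
  rw [abs_mul]
  exact mul_le_mul (hC t ht) (abs_kernelS_le hx ht) (abs_nonneg _) ((norm_nonneg _).trans (hC t ht))

theorem exists_abs_qDS_le (hx : x ∈ Icc a ((a + b) / 2)) :
    ∃ C, ∀ t ∈ Icc a b, |qDS a b Q (m + 2) x t| ≤ C := by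
  obtain ⟨C, hC⟩ := isCompact_Icc.exists_bound_of_continuousOn
    (s := Icc a b) (Q (m + 1)).continuous.continuousOn
  obtain ⟨D, hD⟩ := isCompact_Icc.exists_bound_of_continuousOn
    (s := Icc a b) (Q m).continuous.continuousOn
  refine ⟨C + D * (b - a), fun t ht => ?_⟩
  show |(Q (m + 1)).eval t + (Q m).eval t * kernelS a b x t| ≤ _
  refine (abs_add_le _ _).trans (add_le_add (hC t ht) ?_)
  rw [abs_mul]
  exact mul_le_mul (hD t ht) (abs_kernelS_le hx ht) (abs_nonneg _) ((norm_nonneg _).trans (hD t ht))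

theorem memLp_qS {p : ENNReal} (hx : x ∈ Icc a ((a + b) / 2)) :
    MemLp (qS a b Q (m + 2) x) p (volume.restrict (Icc a b)) :=
  (exists_abs_qS_le hx).elim fun _ hC => memLp_of_bounded measurable_qS hC

theorem memLp_qDS {p : ENNReal} (hx : x ∈ Icc a ((a + b) / 2)) :
    MemLp (qDS a b Q (m + 2) x) p (volume.restrict (Icc a b)) :=
  (exists_abs_qDS_le hx).elim fun _ hC => memLp_of_bounded measurable_qDS hC

theorem lowerM_le_qS_le_upperM (hx : x ∈ Icc a ((a + b) / 2)) {t : ℝ} (ht : t ∈ Icc a b) :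
    lowerM a b Q (m + 2) x ≤ qS a b Q (m + 2) x t ∧
      qS a b Q (m + 2) x t ≤ upperM a b Q (m + 2) x := by
  obtain ⟨C, hC⟩ := exists_abs_qS_le (Q := Q) (m := m) hx
  constructor
  · refine csInf_le ⟨-C, ?_⟩ (mem_image_of_mem _ ht)
    rintro _ ⟨s, hs, rfl⟩
    exact (abs_le.1 (hC s hs)).1
  · refine le_csSup ⟨C, ?_⟩ (mem_image_of_mem _ ht)
    rintro _ ⟨s, hs, rfl⟩
    exact (abs_le.1 (hC s hs)).2

theorem abs_sub_le_normOn_qDS_mul (hQ : IsHarmonicSeq Q) (hx : x ∈ Icc a ((a + b) / 2))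
    {c d e : ℝ} (hsub : Icc c d ⊆ Icc a b)
    (hS : EqOn (kernelS a b x) (fun t => t - e) (Ioo c d)) :
    ∀ s ∈ Icc c d, ∀ t ∈ Icc c d, |(Q (m + 1)).eval s * (s - e) - (Q (m + 1)).eval t * (t - e)|
      ≤ normOn a b ⊤ (qDS a b Q (m + 2) x) * |s - t| := by
  refine abs_sub_le_of_ae_abs_deriv_le (u := fun t => (Q (m + 1)).eval t * (t - e))
    (fun t _ => hQ.hasDerivAt_mul_sub m e t)
    (Continuous.continuousOn (by fun_prop)) hsub (fun t ht => ?_)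
    (ae_abs_le_normOn_top (memLp_qDS hx))
  show (Q (m + 1)).eval t + (Q m).eval t * kernelS a b x t = _
  rw [hS ht]

theorem kernelS_eqOn_left_piece : EqOn (kernelS a b x) (fun t => t - a) (Ioo a x) :=
  kernelS_eqOn_left.mono fun _ ht => ht.2.le

theorem kernelS_eqOn_right_piece (hx : x ≤ (a + b) / 2) :
    EqOn (kernelS a b x) (fun t => t - b) (Ioo (a + b - x) b) :=
  fun _ ht => kernelS_eq_right (by linarith [ht.1]) ht.1.le

theorem hasValueDensity_qS (hQ : IsHarmonicSeq Q) (hx : x ∈ Icc a ((a + b) / 2)) :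
    HasValueDensity (volume.restrict (Icc a b)) (Icc a b) (normOn a b ⊤ (qDS a b Q (m + 2) x))
      (qS a b Q (m + 2) x) := by
  refine hasValueDensity_of_pinned normOn_nonneg measurable_qS fun y hy => ?_
  obtain ⟨hax, hxm⟩ := hx
  have hmain : ∀ c d e : ℝ, Icc c d ⊆ Icc a b → e ∈ Icc c d → y ∈ Icc c d →
      EqOn (kernelS a b x) (fun t => t - e) (Ioo c d) → kernelS a b x y = y - e →
      ∃ e ∈ Icc a b, ∃ u : ℝ → ℝ, u e = 0 ∧ u y = qS a b Q (m + 2) x y ∧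
      EqOn (qS a b Q (m + 2) x) u (uIoo y e) ∧
      ∀ s ∈ uIcc y e, ∀ t ∈ uIcc y e,
        |u s - u t| ≤ normOn a b ⊤ (qDS a b Q (m + 2) x) * |s - t| := by
    intro c d e hsub he hyc hS hSy
    have hye := uIcc_subset_Icc hyc he
    refine ⟨e, hsub he, fun t => (Q (m + 1)).eval t * (t - e), by simp, ?_, fun t ht => ?_,
      fun s hs t ht => abs_sub_le_normOn_qDS_mul hQ ⟨hax, hxm⟩ hsub hS s (hye hs) t (hye ht)⟩
    · show _ = (Q (m + 1)).eval y * kernelS a b x y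
      rw [hSy]
    · show (Q (m + 1)).eval t * kernelS a b x t = _
      have ht' : t ∈ Ioo c d :=
        ⟨(le_min hyc.1 he.1).trans_lt ht.1, lt_of_lt_of_le ht.2 (max_le hyc.2 he.2)⟩
      rw [hS ht']
  by_cases h1 : y ≤ x
  · exact hmain a x a (Icc_subset_Icc le_rfl (by linarith)) ⟨le_rfl, hax⟩ ⟨hy.1, h1⟩
      kernelS_eqOn_left_piece (kernelS_eqOn_left h1)
  push Not at h1
  by_cases h2 : y < a + b - x
  · exact hmain x (a + b - x) ((a + b) / 2) (Icc_subset_Icc hax (by linarith))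
      ⟨hxm, by linarith⟩ ⟨h1.le, h2.le⟩ kernelS_eqOn_middle (kernelS_eqOn_middle ⟨h1, h2⟩)
  push Not at h2
  exact hmain (a + b - x) b b (Icc_subset_Icc (by linarith) le_rfl) ⟨by linarith, le_rfl⟩
    ⟨h2, hy.2⟩ (kernelS_eqOn_right_piece hxm) (kernelS_eq_right h1 h2)

theorem integral_qS_sq_le_normOn_top (hQ : IsHarmonicSeq Q) (hab : a ≤ b)
    (hx : x ∈ Icc a ((a + b) / 2)) :
    ∫ t in Icc a b, qS a b Q (m + 2) x t ^ 2
      ≤ normOn a b ⊤ (qDS a b Q (m + 2) x) ^ 2 * (b - a) ^ 3 / 12 := by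
  have hx' := hx
  obtain ⟨hax, hxm⟩ := hx'
  refine (integral_Icc_comp_kernelS hab hx (G := fun t s => ((Q (m + 1)).eval t * s) ^ 2)
    (by fun_prop)).trans_le ?_
  set K := normOn a b ⊤ (qDS a b Q (m + 2) x) with hK
  have key : ∀ c d e : ℝ, c ≤ d → Icc c d ⊆ Icc a b → e ∈ Icc c d →
      EqOn (kernelS a b x) (fun t => t - e) (Ioo c d) →
      ∫ t in c..d, ((Q (m + 1)).eval t * (t - e)) ^ 2
        ≤ K ^ 2 * ((d - e) ^ 3 - (c - e) ^ 3) / 3 := by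
    intro c d e hcd hsub he hS
    refine integral_sq_le_of_abs_le_mul (u := fun t => (Q (m + 1)).eval t * (t - e)) hcd
      (Continuous.continuousOn (by fun_prop)) fun t ht => ?_
    have := abs_sub_le_normOn_qDS_mul (m := m) hQ hx hsub hS t ht e he
    simpa using this
  have k1 := key a x a hax (Icc_subset_Icc le_rfl (by linarith)) ⟨le_rfl, hax⟩
    kernelS_eqOn_left_piece
  have k2 := key x (a + b - x) ((a + b) / 2) (by linarith) (Icc_subset_Icc hax (by linarith))
    ⟨hxm, by linarith⟩ kernelS_eqOn_middle
  have k3 := key (a + b - x) b b (by linarith) (Icc_subset_Icc (by linarith) le_rfl)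
    ⟨by linarith, le_rfl⟩ (kernelS_eqOn_right_piece hxm)
  refine (add_le_add (add_le_add k1 k2) k3).trans ?_
  have hr : 0 ≤ x - a := by linarith
  have hs : 0 ≤ (a + b) / 2 - x := by linarith
  -- The pieces contribute `2 K² / 3` times the left side, which is superadditivity of the cube on
  -- nonnegative numbers. The right side corresponds to `x = a` or `x = (a + b) / 2`.
  have hpoly : (x - a) ^ 3 + ((a + b) / 2 - x) ^ 3 ≤ ((b - a) / 2) ^ 3 := by
    have e : (b - a) / 2 = (x - a) + ((a + b) / 2 - x) := by ring
    rw [e]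
    nlinarith [mul_nonneg (mul_nonneg hr hs) (add_nonneg hr hs)]
  have := mul_le_mul_of_nonneg_left hpoly (sq_nonneg K)
  linear_combination (2 / 3) * this

theorem integral_qS_sq_le_normD (hQ : IsHarmonicSeq Q) (hab : a ≤ b)
    (hx : x ∈ Icc a ((a + b) / 2)) :
    ∫ t in Icc a b, qS a b Q (m + 2) x t ^ 2
      ≤ ((b - a) / Real.pi * normD a b Q (m + 2) x) ^ 2 := by
  have hx' := hx
  obtain ⟨hax, hxm⟩ := hx'
  have hD : normD a b Q (m + 2) x ^ 2 = ∫ t in Icc a b, qDS a b Q (m + 2) x t ^ 2 := by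
    rw [normD, Real.sq_sqrt (intervalIntegral.integral_nonneg hab fun t _ => sq_nonneg _),
      intervalIntegral.integral_of_le hab, integral_Icc_eq_integral_Ioc]
    simp only [sq_abs]
  rw [mul_pow, hD]
  have hcomp := integral_Icc_comp_kernelS hab hx
    (G := fun t s => ((Q (m + 1)).eval t + (Q m).eval t * s) ^ 2) (by fun_prop)
  refine (integral_Icc_comp_kernelS hab hx (G := fun t s => ((Q (m + 1)).eval t * s) ^ 2)
    (by fun_prop)).trans_le ?_
  refine le_of_le_of_eq ?_ (congrArg (((b - a) / Real.pi) ^ 2 * ·) hcomp.symm)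
  set e := (a + b) / 2 with he
  have scale : ∀ c d e : ℝ, c ≤ d → 2 * (d - c) ≤ b - a →
      (2 * (d - c) / Real.pi) ^ 2
        * (∫ t in c..d, ((Q (m + 1)).eval t + (Q m).eval t * (t - e)) ^ 2)
      ≤ ((b - a) / Real.pi) ^ 2
        * ∫ t in c..d, ((Q (m + 1)).eval t + (Q m).eval t * (t - e)) ^ 2 := by
    intro c d e hcd hle
    refine mul_le_mul_of_nonneg_right ?_
      (intervalIntegral.integral_nonneg hcd fun t _ => sq_nonneg _)
    have := Real.pi_pos
    refine pow_le_pow_left₀ (div_nonneg (by linarith) this.le) ?_ 2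
    exact div_le_div_of_nonneg_right hle this.le
  have left : ∀ c d : ℝ, c ≤ d → 2 * (d - c) ≤ b - a →
      ∫ t in c..d, ((Q (m + 1)).eval t * (t - c)) ^ 2 ≤ ((b - a) / Real.pi) ^ 2
        * ∫ t in c..d, ((Q (m + 1)).eval t + (Q m).eval t * (t - c)) ^ 2 := fun c d hcd hle =>
    (integral_sq_le_of_eq_zero_left hcd (fun t _ => hQ.hasDerivAt_mul_sub m c t)
      (Continuous.continuousOn (by fun_prop)) (by simp)).trans (scale c d c hcd hle)
  have right : ∀ c d : ℝ, c ≤ d → 2 * (d - c) ≤ b - a →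
      ∫ t in c..d, ((Q (m + 1)).eval t * (t - d)) ^ 2 ≤ ((b - a) / Real.pi) ^ 2
        * ∫ t in c..d, ((Q (m + 1)).eval t + (Q m).eval t * (t - d)) ^ 2 := fun c d hcd hle =>
    (integral_sq_le_of_eq_zero_right hcd (fun t _ => hQ.hasDerivAt_mul_sub m d t)
      (Continuous.continuousOn (by fun_prop)) (by simp)).trans (scale c d d hcd hle)
  -- Cutting the middle piece at its zero `e` leaves four intervals of length at most `(b - a) / 2`,
  -- each with a zero at an end. Every Wirtinger constant is then at most `(b - a) / π`.
  have k1 := left a x hax (by linarith)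
  have k2 := right x e hxm (by linarith)
  have k3 := left e (a + b - x) (by linarith) (by linarith)
  have k4 := right (a + b - x) b (by linarith) (by linarith)
  rw [← intervalIntegral.integral_add_adjacent_intervals (a := x) (b := e) (c := a + b - x)
      (f := fun t => ((Q (m + 1)).eval t * (t - e)) ^ 2)
      (Continuous.intervalIntegrable (by fun_prop) _ _)
      (Continuous.intervalIntegrable (by fun_prop) _ _),
    ← intervalIntegral.integral_add_adjacent_intervals (a := x) (b := e) (c := a + b - x)
      (f := fun t => ((Q (m + 1)).eval t + (Q m).eval t * (t - e)) ^ 2)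
      (Continuous.intervalIntegrable (by fun_prop) _ _)
      (Continuous.intervalIntegrable (by fun_prop) _ _)]
  linear_combination k1 + k2 + k3 + k4

end Harmonic

/-! ### Deviation of a smooth function from its midpoint value -/

section Smooth

variable {g g' : ℝ → ℝ} {a b : ℝ}

theorem integral_sq_sub_midpoint_value_le_top (hab : a ≤ b)
    (hg : ∀ t ∈ Icc a b, HasDerivAt g (g' t) t) (hg' : ContinuousOn g' (Icc a b)) :
    ∫ t in Icc a b, (g t - g ((a + b) / 2)) ^ 2 ≤ normOn a b ⊤ g' ^ 2 * (b - a) ^ 3 / 12 := by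
  have hL := abs_sub_le_of_ae_abs_deriv_le hg hg' subset_rfl (fun _ _ => rfl)
    (ae_abs_le_normOn_top (memLp_of_continuousOn hg'))
  have hcg : ContinuousOn g (Icc a b) := fun t ht => (hg t ht).continuousAt.continuousWithinAt
  rw [integral_Icc_eq_integral_Ioc, ← intervalIntegral.integral_of_le hab]
  refine (integral_sq_le_of_abs_le_mul (e := (a + b) / 2) hab (by fun_prop)
    fun t ht => hL t ht _ ⟨by linarith, by linarith⟩).trans_eq ?_
  ring

theorem integral_sq_sub_midpoint_value_le_two (hab : a ≤ b)
    (hg : ∀ t ∈ Icc a b, HasDerivAt g (g' t) t) (hg' : ContinuousOn g' (Icc a b)) :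
    ∫ t in Icc a b, (g t - g ((a + b) / 2)) ^ 2 ≤ ((b - a) / Real.pi * normOn a b 2 g') ^ 2 := by
  rw [mul_pow, normOn_two_sq hab (memLp_of_continuousOn hg'), integral_Icc_eq_integral_Ioc,
    ← intervalIntegral.integral_of_le hab]
  set e := (a + b) / 2 with he
  have hae : a ≤ e := by linarith
  have heb : e ≤ b := by linarith
  have s1 : Icc a e ⊆ Icc a b := Icc_subset_Icc le_rfl heb
  have s2 : Icc e b ⊆ Icc a b := Icc_subset_Icc hae le_rfl
  have hcg : ContinuousOn g (Icc a b) := fun t ht => (hg t ht).continuousAt.continuousWithinAt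
  have k1 := integral_sq_le_of_eq_zero_right (u := fun t => g t - g e) hae
    (fun t ht => (hg t (s1 ht)).sub_const _) (hg'.mono s1) (sub_self _)
  have k2 := integral_sq_le_of_eq_zero_left (u := fun t => g t - g e) heb
    (fun t ht => (hg t (s2 ht)).sub_const _) (hg'.mono s2) (sub_self _)
  rw [show 2 * (e - a) = b - a by rw [he]; ring] at k1
  rw [show 2 * (b - e) = b - a by rw [he]; ring] at k2
  have int : ∀ {φ : ℝ → ℝ} {c d : ℝ}, c ≤ d → ContinuousOn φ (Icc a b) → Icc c d ⊆ Icc a b →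
      IntervalIntegrable φ volume c d := fun hcd hφ hsub =>
    (hφ.mono ((uIcc_of_le hcd).trans_subset hsub)).intervalIntegrable
  have c1 : ContinuousOn (fun t => (g t - g e) ^ 2) (Icc a b) := by fun_prop
  have c2 : ContinuousOn (fun t => g' t ^ 2) (Icc a b) := by fun_prop
  rw [← intervalIntegral.integral_add_adjacent_intervals (int hae c1 s1) (int heb c1 s2),
    ← intervalIntegral.integral_add_adjacent_intervals (int hae c2 s1) (int heb c2 s2)]
  linear_combination k1 + k2

end Smooth

/-! ### The remainder as a Chebyshev functional -/

section Remainder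

variable {a b x : ℝ} {Q : ℕ → Polynomial ℝ} {m : ℕ} {f : ℝ → ℝ}

theorem abs_remainderL (hQ : IsHarmonicSeq Q) (hab : a < b) (hx : x ∈ Icc a ((a + b) / 2))
    (hf : ∀ t ∈ Icc a b, HasDerivAt (iteratedDeriv (m + 1) f) (iteratedDeriv (m + 2) f t) t)
    (hc : ContinuousOn (iteratedDeriv (m + 2) f) (Icc a b)) :
    |remainderL a b Q (m + 2) f x|
      = |(∫ t in Icc a b, qS a b Q (m + 2) x t * iteratedDeriv (m + 2) f t)
          - (∫ t in Icc a b, qS a b Q (m + 2) x t) * (∫ t in Icc a b, iteratedDeriv (m + 2) f t)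
            / (b - a)| / (((m + 2 : ℕ) : ℝ) * (b - a)) := by
  have hL : 0 < b - a := sub_pos.2 hab
  have hn : (0 : ℝ) < ((m + 2 : ℕ) : ℝ) := by positivity
  have hFTC : ∫ t in Icc a b, iteratedDeriv (m + 2) f t
      = iteratedDeriv (m + 1) f b - iteratedDeriv (m + 1) f a := by
    rw [integral_Icc_eq_integral_Ioc, ← intervalIntegral.integral_of_le hab.le]
    refine intervalIntegral.integral_eq_sub_of_hasDerivAt ?_ ?_
    · rwa [uIcc_of_le hab.le]
    · exact ContinuousOn.intervalIntegrable (by rwa [uIcc_of_le hab.le])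
  have hint : ∫ t in a..b, (Q (m + 2 - 1)).eval t * kernelS a b x t * iteratedDeriv (m + 2) f t
      = ∫ t in Icc a b, qS a b Q (m + 2) x t * iteratedDeriv (m + 2) f t := by
    rw [intervalIntegral.integral_of_le hab.le, integral_Icc_eq_integral_Ioc]; rfl
  have hrem : remainderL a b Q (m + 2) f x = (-1) ^ (m + 1) *
      (((∫ t in Icc a b, qS a b Q (m + 2) x t * iteratedDeriv (m + 2) f t)
          - (∫ t in Icc a b, qS a b Q (m + 2) x t) * (∫ t in Icc a b, iteratedDeriv (m + 2) f t)
            / (b - a)) / (((m + 2 : ℕ) : ℝ) * (b - a))) := by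
    rw [remainderL, hint, integral_qS hQ hab.le hx, hFTC]
    simp only [show m + 2 - 1 = m + 1 from rfl, show m + 2 + 1 = m + 3 from rfl]
    field_simp
  rw [hrem, abs_mul, abs_pow, abs_neg, abs_one, one_pow, one_mul, abs_div,
    abs_of_pos (mul_pos hn hL)]

end Remainder

end GuessabSchmeisser

/-! ### The five estimates -/

theorem mainTheorem9 (I : Set ℝ) (hI : I.OrdConnected) (a b : ℝ)
    (ha : a ∈ interior I) (hb : b ∈ interior I) (hab : a < b)
    (Q : ℕ → Polynomial ℝ) (hQ : GuessabSchmeisser.IsHarmonicSeq Q)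
    (n : ℕ) (hn : 2 ≤ n) (f : ℝ → ℝ)
    (hdiff : ∀ k ≤ n, DifferentiableOn ℝ (iteratedDeriv k f) (interior I))
    (hac : GuessabSchmeisser.IsAbsContOn (iteratedDeriv (n + 1) f) (interior I))
    (x : ℝ) (hx : x ∈ Set.Icc a ((a + b) / 2)) :
    (GuessabSchmeisser.MemLpOn a b ⊤ (iteratedDeriv (n + 1) f) →
      |GuessabSchmeisser.remainderL a b Q n f x| ≤
        (b - a) ^ 2 / (12 * n)
          * GuessabSchmeisser.normOn a b ⊤ (GuessabSchmeisser.qDS a b Q n x)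
          * GuessabSchmeisser.normOn a b ⊤ (iteratedDeriv (n + 1) f)) ∧
    (∀ m₁ M₁ : ℝ, (∀ t ∈ Set.Icc a b, m₁ ≤ iteratedDeriv n f t ∧ iteratedDeriv n f t ≤ M₁) →
      |GuessabSchmeisser.remainderL a b Q n f x| ≤
        1 / (4 * n) * (M₁ - m₁)
          * (GuessabSchmeisser.upperM a b Q n x - GuessabSchmeisser.lowerM a b Q n x)) ∧
    (GuessabSchmeisser.MemLpOn a b 2 (iteratedDeriv (n + 1) f) →
      |GuessabSchmeisser.remainderL a b Q n f x| ≤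
        (b - a) / (Real.pi ^ 2 * n) * GuessabSchmeisser.normD a b Q n x
          * GuessabSchmeisser.normOn a b 2 (iteratedDeriv (n + 1) f)) ∧
    (∀ m₁ M₁ : ℝ, (∀ t ∈ Set.Icc a b, m₁ ≤ iteratedDeriv n f t ∧ iteratedDeriv n f t ≤ M₁) →
      |GuessabSchmeisser.remainderL a b Q n f x| ≤
        (b - a) / (8 * n)
          * GuessabSchmeisser.normOn a b ⊤ (GuessabSchmeisser.qDS a b Q n x) * (M₁ - m₁)) ∧
    (GuessabSchmeisser.MemLpOn a b ⊤ (iteratedDeriv (n + 1) f) →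
      |GuessabSchmeisser.remainderL a b Q n f x| ≤
        (b - a) / (8 * n)
          * (GuessabSchmeisser.upperM a b Q n x - GuessabSchmeisser.lowerM a b Q n x)
          * GuessabSchmeisser.normOn a b ⊤ (iteratedDeriv (n + 1) f)) := by
  obtain ⟨m, rfl⟩ : ∃ m, n = m + 2 := ⟨n - 2, by omega⟩
  have hsub : Icc a b ⊆ interior I := hI.interior.out ha hb
  have hderiv : ∀ k ≤ m + 2, ∀ t ∈ Icc a b,
      HasDerivAt (iteratedDeriv k f) (iteratedDeriv (k + 1) f t) t := by
    intro k hk t ht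
    rw [iteratedDeriv_succ]
    exact ((hdiff k hk).differentiableAt (isOpen_interior.mem_nhds (hsub ht))).hasDerivAt
  have hcg' : ContinuousOn (iteratedDeriv (m + 2 + 1) f) (Icc a b) := by
    have := (hac a ha b hb hab.le).continuousOn
    rwa [uIcc_of_le hab.le] at this
  have hg := hderiv (m + 2) le_rfl
  have hcg : ContinuousOn (iteratedDeriv (m + 2) f) (Icc a b) :=
    fun t ht => (hg t ht).continuousAt.continuousWithinAt
  rw [GuessabSchmeisser.abs_remainderL hQ hab hx (hderiv (m + 1) (by omega)) hcg]
  set g := iteratedDeriv (m + 2) f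
  set g' := iteratedDeriv (m + 2 + 1) f
  set h := GuessabSchmeisser.qS a b Q (m + 2) x with hh
  have hL : 0 < b - a := sub_pos.2 hab
  have hn0 : (0 : ℝ) < ((m + 2 : ℕ) : ℝ) := by positivity
  have huniv : (volume.restrict (Icc a b)).real univ = b - a := by
    simp [hab.le]
  have hμ : (volume.restrict (Icc a b)).real univ ≠ 0 := by rw [huniv]; exact hL.ne'
  -- The Ostrowski bound asks for measurability on all of `ℝ`, where `f` need not be regular; a
  -- `deriv` is measurable regardless.
  have hgm : Measurable g := by
    simp only [g, iteratedDeriv_succ]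
    exact measurable_deriv _
  have hhLp : MemLp h 2 (volume.restrict (Icc a b)) := GuessabSchmeisser.memLp_qS hx
  have hgLp : MemLp g 2 (volume.restrict (Icc a b)) := GuessabSchmeisser.memLp_of_continuousOn hcg
  have hmem : ∀ᵐ t ∂volume.restrict (Icc a b), t ∈ Icc a b := ae_restrict_mem measurableSet_Icc
  have hhb : ∀ᵐ t ∂volume.restrict (Icc a b), GuessabSchmeisser.lowerM a b Q (m + 2) x ≤ h t ∧
      h t ≤ GuessabSchmeisser.upperM a b Q (m + 2) x := by
    filter_upwards [hmem] with t ht using GuessabSchmeisser.lowerM_le_qS_le_upperM hx ht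
  have haI : a ∈ Icc a b := left_mem_Icc.2 hab.le
  have hmM : GuessabSchmeisser.lowerM a b Q (m + 2) x ≤ GuessabSchmeisser.upperM a b Q (m + 2) x :=
    (GuessabSchmeisser.lowerM_le_qS_le_upperM hx haI).1.trans
      (GuessabSchmeisser.lowerM_le_qS_le_upperM hx haI).2
  have hsq : ∀ K : ℝ, (K * Real.sqrt ((b - a) ^ 3 / 12)) ^ 2 = K ^ 2 * (b - a) ^ 3 / 12 := by
    intro K
    rw [mul_pow, Real.sq_sqrt (by positivity)]
    ring
  refine ⟨fun _ => ?_, fun m₁ M₁ hb₁ => ?_, fun _ => ?_, fun m₁ M₁ hb₁ => ?_, fun _ => ?_⟩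
  -- Here `c = 0`, since the branches of `h` vanish at their zeros, and `d` is the midpoint value of
  -- `g`.
  · have key := GuessabSchmeisser.abs_chebyshev_le_of_integral_sq_le hμ hhLp hgLp (c := 0)
      (mul_nonneg GuessabSchmeisser.normOn_nonneg (Real.sqrt_nonneg ((b - a) ^ 3 / 12)))
      (mul_nonneg GuessabSchmeisser.normOn_nonneg (Real.sqrt_nonneg ((b - a) ^ 3 / 12)))
      (by simpa only [sub_zero, hsq] using
        GuessabSchmeisser.integral_qS_sq_le_normOn_top hQ hab.le hx)
      (by simpa only [hsq] using
        GuessabSchmeisser.integral_sq_sub_midpoint_value_le_top hab.le hg hcg')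
    rw [huniv] at key
    rw [div_le_iff₀ (by positivity)]
    refine key.trans_eq ?_
    rw [mul_mul_mul_comm, Real.mul_self_sqrt (by positivity)]
    field_simp
  · have hle : m₁ ≤ M₁ := (hb₁ a haI).1.trans (hb₁ a haI).2
    have key := GuessabSchmeisser.abs_chebyshev_le_gruss hμ hhLp hgLp hmM hle hhb
      (by filter_upwards [hmem] with t ht using hb₁ t ht)
    rw [huniv] at key
    rw [div_le_iff₀ (by positivity)]
    refine key.trans_eq ?_
    field_simp
  · have key := GuessabSchmeisser.abs_chebyshev_le_of_integral_sq_le hμ hhLp hgLp (c := 0)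
      (A := (b - a) / Real.pi * GuessabSchmeisser.normD a b Q (m + 2) x)
      (mul_nonneg (div_nonneg hL.le Real.pi_pos.le) (Real.sqrt_nonneg _))
      (mul_nonneg (div_nonneg hL.le Real.pi_pos.le) GuessabSchmeisser.normOn_nonneg)
      (by simpa only [sub_zero] using
        GuessabSchmeisser.integral_qS_sq_le_normD hQ hab.le hx)
      (GuessabSchmeisser.integral_sq_sub_midpoint_value_le_two hab.le hg hcg')
    rw [huniv] at key
    rw [div_le_iff₀ (by positivity)]
    refine key.trans_eq ?_
    have := Real.pi_pos
    field_simp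
  · have hle : m₁ ≤ M₁ := (hb₁ a haI).1.trans (hb₁ a haI).2
    have key := (GuessabSchmeisser.hasValueDensity_qS (m := m) hQ hx).abs_chebyshev_le
      GuessabSchmeisser.normOn_nonneg hmem GuessabSchmeisser.measurable_qS hμ hhLp hgLp hle
      (by filter_upwards [hmem] with t ht using hb₁ t ht)
    rw [huniv, mul_comm (∫ t in Icc a b, g t)] at key
    simp only [mul_comm (g _)] at key
    rw [div_le_iff₀ (by positivity)]
    refine key.trans_eq ?_
    field_simp
  -- Roles exchanged: `g` is now the Lipschitz function and `h` the bounded one.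
  · have hlip := GuessabSchmeisser.abs_sub_le_of_ae_abs_deriv_le hg hcg' subset_rfl
      (fun _ _ => rfl) (GuessabSchmeisser.ae_abs_le_normOn_top
        (GuessabSchmeisser.memLp_of_continuousOn hcg'))
    have key := (GuessabSchmeisser.hasValueDensity_of_lipschitz
      GuessabSchmeisser.normOn_nonneg hlip).abs_chebyshev_le
      GuessabSchmeisser.normOn_nonneg hmem hgm hμ hgLp hhLp hmM hhb
    rw [huniv] at key
    rw [div_le_iff₀ (by positivity)]
    refine key.trans_eq ?_
    field_simp
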